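/- Let $p\ge 2$ be an integer and let $V:\mathbb{Z}\to\mathbb{R}$ be $p$-periodic, $V_{n+p}=V_n$, and non-degenerate, i.e. its gap $\gamma:=\min_{0<|j-k|<p}|V_j-V_k|$ is positive; let $\Gamma:=\max_{0<|j-k|<p}|V_j-V_k|$. For $\mu>0$ let $H_\mu$ be the bounded self-adjoint operator on $\ell^2(\mathbb{Z})$ given by $[H_\mu\psi](n)=\psi(n+1)+\psi(n-1)+\mu V_n\psi(n)$. Let $\{\delta_n\}_{n\in\mathbb{Z}}$ be the canonical basis of $\ell^2(\mathbb{Z})$ and let $X$ be the position operator counting period cells, $X\delta_{pj+m}=|j|\,\delta_{pj+m}$ for $j\in\mathbb{Z}$, $m\in\{0,\dots,p-1\}$, with its maximal domain $D(X)$. For $\eta_0>0$ define $\mu_0=\mu_0(\eta_0,\gamma,\Gamma,p)>0$ by $$\mu_0^2=\max\Big\{1,\,2\hat C\,(2/\gamma)^p\Big\},\qquad \hat C=2^p(\Gamma+\gamma/2)^p+(\Gamma+\gamma/2+2)^{p-2}+2e^{\eta_0}+\frac{1}{2e^{\eta_0}}.$$ Then for every $\eta_0>0$ and every $\mu\ge\mu_0$: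 $e^{-itH_\mu}\delta_0\in D(X)$ for all $t\in\mathbb{R}$, the limit defining the asymptotic velocity $v_{Asy}^{(\mu)}$ exists, and $$v_{Asy}^{(\mu)}=\lim_{t\to\infty}\frac1t\big\|Xe^{-itH_\mu}\delta_0\big\|\le\frac{C_3}{\mu^{p-1}},\qquad C_3:=4\pi p^2\Big(\frac{2}{\gamma}\Big)^{p-1}.$$ -/

import Mathlib

open Filter Topology

/-- The Hilbert space `ℓ²(ℤ)` of square-summable complex sequences indexed by `ℤ`. -/
abbrev EllTwo : Type := lp (fun _ : ℤ => ℂ) 2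

/-- The canonical basis vector `δ_n` of `ℓ²(ℤ)`. -/
noncomputable def delta (n : ℤ) : EllTwo := lp.single 2 n (1 : ℂ)

theorem memlp_shift (k : ℤ) (ψ : EllTwo) : Memℓp (fun n : ℤ => ψ (n + k)) 2 := by
  apply memℓp_gen
  have h := (lp.memℓp ψ).summable (by norm_num)
  exact (Equiv.addRight k).summable_iff.mpr h

/-- The translation `(S_k ψ)(n) = ψ(n + k)`, as a bounded operator on `ℓ²(ℤ)`. -/
noncomputable def shift (k : ℤ) : EllTwo →L[ℂ] EllTwo :=
  LinearMap.mkContinuous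
    { toFun := fun ψ => ⟨fun n => ψ (n + k), memlp_shift k ψ⟩
      map_add' := fun _ _ => rfl
      map_smul' := fun _ _ => rfl } 1 (by
    intro ψ
    rw [one_mul]
    refine lp.norm_le_of_tsum_le (by norm_num) (norm_nonneg _) ?_
    rw [lp.norm_rpow_eq_tsum (by norm_num) ψ]
    exact ((Equiv.addRight k).tsum_eq (fun n => ‖ψ n‖ ^ (2 : ENNReal).toReal)).le)

theorem memlp_mul (a : ℤ → ℂ) (C : ℝ) (ha : ∀ n, ‖a n‖ ≤ C) (ψ : EllTwo) :
    Memℓp (fun n : ℤ => a n * ψ n) 2 := by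
  have hs := (lp.memℓp ((C : ℂ) • ψ)).summable (p := 2) (by norm_num)
  refine memℓp_gen (hs.of_nonneg_of_le (fun n => by positivity) fun n => ?_)
  have hC : 0 ≤ C := (norm_nonneg _).trans (ha n)
  refine Real.rpow_le_rpow (norm_nonneg _) ?_ (by norm_num)
  rw [lp.coeFn_smul, Pi.smul_apply, norm_mul, norm_smul, Complex.norm_real, Real.norm_of_nonneg hC]
  exact mul_le_mul_of_nonneg_right (ha n) (norm_nonneg _)

theorem potential_norm_le {V : ℤ → ℝ} (hV : ∃ C : ℝ, ∀ n, |V n| ≤ C) :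
    ∀ n, ‖(V n : ℂ)‖ ≤ hV.choose := by
  intro n
  rw [Complex.norm_real]
  exact hV.choose_spec n

/-- Multiplication by a bounded real potential, `(V ψ)(n) = V_n ψ(n)`, as a bounded operator
on `ℓ²(ℤ)`. -/
noncomputable def potentialOp (V : ℤ → ℝ) (hV : ∃ C : ℝ, ∀ n, |V n| ≤ C) : EllTwo →L[ℂ] EllTwo :=
  LinearMap.mkContinuous
    { toFun := fun ψ => ⟨fun n => (V n : ℂ) * ψ n, memlp_mul _ _ (potential_norm_le hV) ψ⟩
      map_add' := fun ψ φ => by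
        ext n
        exact mul_add _ _ _
      map_smul' := fun c ψ => by
        ext n
        exact mul_left_comm _ _ _ } hV.choose (by
    intro ψ
    have hC : 0 ≤ hV.choose := (norm_nonneg _).trans (potential_norm_le hV 0)
    have h : ‖((hV.choose : ℝ) : ℂ) • ψ‖ = hV.choose * ‖ψ‖ := by
      rw [norm_smul, Complex.norm_real, Real.norm_of_nonneg hC]
    rw [← h]
    refine lp.norm_mono (by norm_num) fun n => ?_
    change ‖(V n : ℂ) * ψ n‖ ≤ ‖((hV.choose : ℝ) : ℂ) • ψ n‖
    rw [norm_mul, norm_smul, Complex.norm_real hV.choose, Real.norm_of_nonneg hC]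
    exact mul_le_mul_of_nonneg_right (potential_norm_le hV n) (norm_nonneg _))

/-- The discrete Laplacian `(Δ ψ)(n) = ψ(n + 1) + ψ(n - 1)` on `ℓ²(ℤ)`. -/
noncomputable def discreteLaplacian : EllTwo →L[ℂ] EllTwo := shift 1 + shift (-1)

/-- The discrete Schrödinger operator `H_μ = Δ + μ V` on `ℓ²(ℤ)`. -/
noncomputable def hamiltonian (V : ℤ → ℝ) (hV : ∃ C : ℝ, ∀ n, |V n| ≤ C) (μ : ℝ) :
    EllTwo →L[ℂ] EllTwo :=
  discreteLaplacian + (μ : ℂ) • potentialOp V hV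

theorem hamiltonian_apply (V : ℤ → ℝ) (hV : ∃ C : ℝ, ∀ n, |V n| ≤ C) (μ : ℝ)
    (ψ : EllTwo) (n : ℤ) :
    hamiltonian V hV μ ψ n = (ψ (n + 1) + ψ (n - 1)) + μ * V n * ψ n := by
  rw [mul_assoc]
  rfl

/-- A periodic potential is bounded. -/
theorem periodic_bounded {p : ℕ} (hp : 2 ≤ p) {V : ℤ → ℝ} (hV : Function.Periodic V (p : ℤ)) :
    ∃ C : ℝ, ∀ n, |V n| ≤ C := by
  refine ⟨∑ m ∈ Finset.range p, |V m|, fun n => ?_⟩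
  have hp0 : (0 : ℤ) < p := by omega
  have h1 : V n = V ((n % p).toNat : ℤ) := by
    rw [Int.toNat_of_nonneg (Int.emod_nonneg _ hp0.ne'), Int.emod_def]
    have := hV.sub_zsmul_eq (x := n) (n / p)
    rw [smul_eq_mul, mul_comm] at this
    exact this.symm
  rw [h1]
  refine Finset.single_le_sum (f := fun m : ℕ => |V m|) (fun _ _ => abs_nonneg _) ?_
  rw [Finset.mem_range]
  have h2 := Int.emod_lt_of_pos n hp0
  have h3 := Int.emod_nonneg n hp0.ne'
  omega

/-- The unitary time evolution `e^{-itH}` of a bounded operator `H`. -/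
noncomputable def timeEvolution (H : EllTwo →L[ℂ] EllTwo) (t : ℝ) : EllTwo →L[ℂ] EllTwo :=
  NormedSpace.exp ((-(Complex.I * (t : ℂ))) • H)

/-- The distance from the origin `|j|` of the period cell containing the site `n`, where `j` is the
integer with `n = p * j + m`, `0 ≤ m < p` (integer division rounds down). -/
def cellDistance (p : ℕ) (n : ℤ) : ℤ := |n / (p : ℤ)|

theorem cellDistance_eq (p : ℕ) (j m : ℤ) (h0 : 0 ≤ m) (hm : m < p) :
    cellDistance p (p * j + m) = |j| := by
  have hp : (p : ℤ) ≠ 0 := by omega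
  rw [cellDistance, add_comm, Int.add_mul_ediv_left _ _ hp, Int.ediv_eq_zero_of_lt h0 hm, zero_add]

/-- The (unbounded) position operator `X`, with its maximal domain. Under the identification of
`ℓ²(ℤ)` with `ℂ^p ⊗ ℓ²(ℤ)` that sends `δ_{p j + m}` to `e_{m+1} ⊗ |j⟩`, `0 ≤ m < p`, it is
`X (e_{m+1} ⊗ |j⟩) = |j| (e_{m+1} ⊗ |j⟩)`. -/
noncomputable def position (p : ℕ) : EllTwo →ₗ.[ℂ] EllTwo where
  domain :=
    { carrier := {ψ | Memℓp (fun n : ℤ => (cellDistance p n : ℂ) * ψ n) 2}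
      add_mem' := by
        intro ψ φ hψ hφ
        have h : (fun n : ℤ => (cellDistance p n : ℂ) * (ψ + φ) n) =
            (fun n : ℤ => (cellDistance p n : ℂ) * ψ n) +
              fun n : ℤ => (cellDistance p n : ℂ) * φ n := by
          funext n
          exact mul_add _ _ _
        change Memℓp _ 2
        rw [h]
        exact hψ.add hφ
      zero_mem' := by
        have h : (fun n : ℤ => (cellDistance p n : ℂ) * (0 : EllTwo) n) = 0 := by
          funext n
          exact mul_zero _
        change Memℓp _ 2
        rw [h]
        exact zero_memℓp
      smul_mem' := by
        intro c ψ hψ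
        have h : (fun n : ℤ => (cellDistance p n : ℂ) * (c • ψ) n) =
            c • fun n : ℤ => (cellDistance p n : ℂ) * ψ n := by
          funext n
          exact mul_left_comm _ _ _
        change Memℓp _ 2
        rw [h]
        exact hψ.const_smul c }
  toFun :=
    { toFun := fun ψ => ⟨fun n => (cellDistance p n : ℂ) * (ψ : EllTwo) n, ψ.2⟩
      map_add' := fun ψ φ => by
        ext n
        exact mul_add _ _ _
      map_smul' := fun c ψ => by
        ext n
        exact mul_left_comm _ _ _ }

/-- The set of the numbers `|V_j - V_k|` with `0 < |j - k| < p`. Its minimum is the gap `γ` of the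
potential and its maximum is the range `Γ`. -/
def potentialDifferences (p : ℕ) (V : ℤ → ℝ) : Set ℝ :=
  {d | ∃ j k : ℤ, 0 < |j - k| ∧ |j - k| < p ∧ d = |V j - V k|}

/-- The constant `Ĉ(η₀, γ, Γ, p)`. -/
noncomputable def hatC (η₀ γ Γ : ℝ) (p : ℕ) : ℝ :=
  2 ^ p * (Γ + γ / 2) ^ p + (Γ + γ / 2 + 2) ^ (p - 2) + 2 * Real.exp η₀ + 1 / (2 * Real.exp η₀)

/-- The coupling threshold `μ₀(η₀, γ, Γ, p)`, given by `μ₀² = max {1, 2 Ĉ (2/γ)^p}`. -/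
noncomputable def couplingThreshold (η₀ γ Γ : ℝ) (p : ℕ) : ℝ :=
  Real.sqrt (max 1 (2 * hatC η₀ γ Γ p * (2 / γ) ^ p))

/-! Write H for the Hamiltonian, S for the translation by p sites, Y for multiplication by the
signed cell index, and D for the discriminant, the trace of the monodromy matrix. Cayley–Hamilton
turns the three-term recursion into D(H) = S + S⁻¹ (`aeval_discriminant`), so [Y, D(H)] = S⁻¹ - S
exactly. Modulo commutators with H, the same commutator is D'(H)[Y, H]. Inverting D'(H) gives [Y, H]
= Q + [K, H] with Q = D'(H)⁻¹(S⁻¹ - S) commuting with H (`exists_velocity`).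

Exponentiating, Y e^{-itH}δ₀ equals -it e^{-itH}Qδ₀ up to an error of norm at most 2‖K‖ for all t.
Hence the velocity exists and equals ‖Qδ₀‖ (`exists_tendsto_velocity`), which is at most 2 / min
|D'| over the spectrum, where |D| ≤ 2.

The lower bound on |D'| is elementary. If x is at distance more than 2 from every μV_j, the transfer
matrices preserve a cone, so |D(x)| > 2 with a known sign. Every level c in [-2, 2] is therefore
attained near each μV_j, so D - c has p well-separated real roots, and D' at one root is the product
of its differences with the others (`le_abs_derivative_discriminant`). The threshold on μ makes μγ
large enough for these roots to separate. -/

/-! ### Transfer matrices and the trace identity for periodic recursions. -/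

/-- The product of the transfer matrices `!![a k, -1; 1, 0]`, later indices on the left. -/
def transferProd {R : Type*} [CommRing R] (a : ℕ → R) : ℕ → Matrix (Fin 2) (Fin 2) R
  | 0 => 1
  | k + 1 => !![a k, -1; 1, 0] * transferProd a k

section TransferProd

variable {R : Type*} [CommRing R] (a : ℕ → R)

@[simp] theorem transferProd_zero : transferProd a 0 = 1 := rfl

@[simp] theorem transferProd_succ_zero (k : ℕ) (j : Fin 2) :
    transferProd a (k + 1) 0 j = a k * transferProd a k 0 j - transferProd a k 1 j := by
  simp [transferProd, Matrix.mul_apply, Fin.sum_univ_two, sub_eq_add_neg]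

@[simp] theorem transferProd_succ_one (k : ℕ) (j : Fin 2) :
    transferProd a (k + 1) 1 j = transferProd a k 0 j := by
  simp [transferProd, Matrix.mul_apply, Fin.sum_univ_two]

theorem det_transferProd (k : ℕ) :
    transferProd a k 0 0 * transferProd a k 1 1 - transferProd a k 0 1 * transferProd a k 1 0
      = 1 := by
  induction k with
  | zero => simp
  | succ k ih => simp only [transferProd_succ_zero, transferProd_succ_one]; linear_combination ih

theorem map_transferProd {S : Type*} [CommRing S] (f : R →+* S) (k : ℕ) (i j : Fin 2) :
    f (transferProd a k i j) = transferProd (fun m => f (a m)) k i j := by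
  induction k generalizing i j with
  | zero => fin_cases i <;> fin_cases j <;> simp
  | succ k ih => fin_cases i <;> simp [ih]

/-- A solution of the three-term recursion is propagated by the transfer matrices. -/
theorem transferProd_propagates {E : Type*} [AddCommGroup E] [Module R E] {a : ℤ → R}
    {e : ℤ → E} (he : ∀ n, e (n + 1) = a n • e n - e (n - 1)) (n : ℤ) (k : ℕ) :
    e (n + k) = transferProd (fun m : ℕ => a (n + m)) k 0 0 • e n
        + transferProd (fun m : ℕ => a (n + m)) k 0 1 • e (n - 1) ∧
      e (n + k - 1) = transferProd (fun m : ℕ => a (n + m)) k 1 0 • e n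
        + transferProd (fun m : ℕ => a (n + m)) k 1 1 • e (n - 1) := by
  induction k with
  | zero => simp
  | succ k ih =>
    obtain ⟨h0, h1⟩ := ih
    have h2 := he (n + k)
    rw [h0, h1] at h2
    constructor
    · rw [Nat.cast_succ, ← add_assoc, h2]
      simp only [transferProd_succ_zero]
      module
    · rw [Nat.cast_succ, ← add_assoc, add_sub_cancel_right, h0]
      simp only [transferProd_succ_one]

theorem eq_zero_of_recursion {E : Type*} [AddCommGroup E] [Module R E] {a : ℤ → R}
    {e : ℤ → E} (he : ∀ n, e (n + 1) = a n • e n - e (n - 1)) (h0 : e 0 = 0) (h1 : e (-1) = 0)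
    (n : ℤ) : e n = 0 := by
  suffices h : e n = 0 ∧ e (n - 1) = 0 from h.1
  induction n using Int.induction_on with
  | zero => exact ⟨h0, h1⟩
  | succ k ih => exact ⟨by rw [he, ih.1, ih.2]; simp, by simpa using ih.1⟩
  | pred k ih =>
    refine ⟨ih.2, ?_⟩
    have h := he (-k - 1)
    rw [sub_add_cancel, ih.1, ih.2] at h
    simpa using h.symm

/-- For periodic coefficients, a period-translate sum acts as the trace of the monodromy matrix. -/
theorem add_translates_eq_trace_smul {E : Type*} [AddCommGroup E] [Module R E] {a : ℤ → R}
    {p : ℕ} (ha : Function.Periodic a (p : ℤ))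
    {e : ℤ → E} (he : ∀ n, e (n + 1) = a n • e n - e (n - 1)) (n : ℤ) :
    e (n + p) + e (n - p) = (transferProd (fun m : ℕ => a m) p).trace • e n := by
  rw [← sub_eq_zero]
  have hb : (fun m : ℕ => a (0 + m)) = fun m : ℕ => a m := by simp
  have hc : (fun m : ℕ => a (-p + m)) = fun m : ℕ => a m := by
    funext m
    rw [← ha (-p + m)]
    congr 1
    ring
  obtain ⟨h1, h2⟩ := transferProd_propagates he 0 p
  obtain ⟨h3, h4⟩ := transferProd_propagates he (-p) p
  have hdet := det_transferProd (fun m : ℕ => a m) p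
  rw [hb, zero_add] at h1 h2
  rw [hc, neg_add_cancel] at h3 h4
  rw [zero_sub] at h1 h2 h4
  set A := transferProd (fun m : ℕ => a m) p 0 0
  set B := transferProd (fun m : ℕ => a m) p 0 1
  set C := transferProd (fun m : ℕ => a m) p 1 0
  set D := transferProd (fun m : ℕ => a m) p 1 1
  -- The monodromy matrix has determinant 1, so its adjugate inverts it; the claim is T + T⁻¹ = tr
  -- T.
  have h5 : e (-p) = D • e 0 - B • e (-1) := by
    rw [h3, h4]
    calc e (-p) = (A * D - B * C) • e (-p) := by rw [hdet, one_smul]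
      _ = _ := by module
  have h6 : e (-p - 1) = A • e (-1) - C • e 0 := by
    rw [h3, h4]
    calc e (-p - 1) = (A * D - B * C) • e (-p - 1) := by rw [hdet, one_smul]
      _ = _ := by module
  refine eq_zero_of_recursion (a := a)
    (e := fun n => e (n + p) + e (n - p) - (transferProd (fun m : ℕ => a m) p).trace • e n)
    (fun n => ?_) ?_ ?_ n
  · have k1 := he (n + p)
    have k2 := he (n - p)
    rw [ha n] at k1
    rw [ha.sub_eq n] at k2
    have e1 : n + 1 + (p : ℤ) = n + p + 1 := by ring
    have e2 : n + 1 - (p : ℤ) = n - p + 1 := by ring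
    have e3 : n - 1 + (p : ℤ) = n + p - 1 := by ring
    have e4 : n - 1 - (p : ℤ) = n - p - 1 := by ring
    simp only [e1, e2, e3, e4]
    rw [k1, k2, he n]
    module
  · simp only [zero_add, zero_sub, Matrix.trace_fin_two]
    rw [h1, h5]
    module
  · have e1 : -1 + (p : ℤ) = p - 1 := by ring
    have e2 : -1 - (p : ℤ) = -p - 1 := by ring
    simp only [e1, e2, Matrix.trace_fin_two]
    rw [h2, h6]
    module

end TransferProd

/-! ### Invariant cone outside the discs of radius 2. -/

section Cone

/-- One transfer step with `2 < |d|` maps the closed cone, up to the sign of `d`, into the interior. -/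
theorem cone_step {P d u w : ℝ} (hd : 2 < |d|) (h1 : 0 ≤ P * (u + w)) (h2 : 0 ≤ P * (u - w))
    (h3 : 0 < P * u) :
    0 < d * P * (d * u - w + u) ∧ 0 < d * P * (d * u - w - u) := by
  -- In the coordinates u + w and u - w, the step times d has coefficients d², d(d - 2), d(d + 2) up
  -- to a factor 1/2, all positive once |d| > 2.
  have hd2 : 4 < d * d := by nlinarith [abs_mul_abs_self d]
  have hm : 0 < d * (d - 2) := by
    rcases lt_abs.mp hd with h | h <;> nlinarith
  have hp : 0 < d * (d + 2) := by
    rcases lt_abs.mp hd with h | h <;> nlinarith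
  constructor
  · have : d * P * (d * u - w + u)
        = (d * d * (P * (u + w)) + d * (d + 2) * (P * (u - w))) / 2 := by ring
    rw [this]
    rcases h1.lt_or_eq with h | h
    · positivity
    · have : 0 < P * (u - w) := by linarith
      positivity
  · have : d * P * (d * u - w - u)
        = (d * (d - 2) * (P * (u + w)) + d * d * (P * (u - w))) / 2 := by ring
    rw [this]
    rcases h1.lt_or_eq with h | h
    · positivity
    · have : 0 < P * (u - w) := by linarith
      positivity

/-- The vectors (1, s) span the two edges of the cone |w| ≤ |u|; multiplying by the product of the d
m keeps track of the sign. -/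
theorem transferProd_cone {d : ℕ → ℝ} (k : ℕ) (hd : ∀ m < k, 2 < |d m|) (s : ℝ)
    (hs : s = 1 ∨ s = -1) :
    let u := transferProd d k 0 0 + s * transferProd d k 0 1
    let w := transferProd d k 1 0 + s * transferProd d k 1 1
    0 ≤ (∏ m ∈ Finset.range k, d m) * (u + w) ∧ 0 ≤ (∏ m ∈ Finset.range k, d m) * (u - w) ∧
      0 < (∏ m ∈ Finset.range k, d m) * u := by
  induction k with
  | zero => rcases hs with rfl | rfl <;> simp
  | succ k ih =>
    obtain ⟨h1, h2, h3⟩ := ih fun m hm => hd m (by omega)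
    obtain ⟨h4, h5⟩ := cone_step (hd k (by omega)) h1 h2 h3
    simp only [transferProd_succ_zero, transferProd_succ_one, Finset.prod_range_succ]
    refine ⟨le_of_lt ?_, le_of_lt ?_, ?_⟩
    · linear_combination h4
    · linear_combination h5
    · linear_combination (h4 + h5) / 2

theorem transferProd_cone_strict {d : ℕ → ℝ} {k : ℕ} (hk : k ≠ 0) (hd : ∀ m < k, 2 < |d m|) (s : ℝ)
    (hs : s = 1 ∨ s = -1) :
    let u := transferProd d k 0 0 + s * transferProd d k 0 1
    let w := transferProd d k 1 0 + s * transferProd d k 1 1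
    0 < (∏ m ∈ Finset.range k, d m) * (u + w) ∧ 0 < (∏ m ∈ Finset.range k, d m) * (u - w) := by
  obtain ⟨k, rfl⟩ := Nat.exists_eq_succ_of_ne_zero hk
  obtain ⟨h1, h2, h3⟩ := transferProd_cone k (fun m hm => hd m (by omega)) s hs
  obtain ⟨h4, h5⟩ := cone_step (hd k (by omega)) h1 h2 h3
  simp only [Nat.succ_eq_add_one, transferProd_succ_zero, transferProd_succ_one,
    Finset.prod_range_succ]
  exact ⟨by linear_combination h4, by linear_combination h5⟩

/-- Outside the discs of radius `2`, the trace exceeds `2` in modulus and has the sign of the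
product of the diagonal entries. -/
theorem prod_mul_trace_sub_pos {d : ℕ → ℝ} {k : ℕ} (hk : k ≠ 0) (hd : ∀ m < k, 2 < |d m|) {c : ℝ}
    (hc : |c| ≤ 2) :
    0 < (∏ m ∈ Finset.range k, d m) * ((transferProd d k).trace - c) := by
  obtain ⟨h1, h2⟩ := transferProd_cone_strict hk hd 1 (Or.inl rfl)
  obtain ⟨h3, h4⟩ := transferProd_cone_strict hk hd (-1) (Or.inr rfl)
  have hdet := det_transferProd d k
  rw [Matrix.trace_fin_two]
  generalize transferProd d k 0 0 = A at *
  generalize transferProd d k 0 1 = B at *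
  generalize transferProd d k 1 0 = C at *
  generalize transferProd d k 1 1 = D at *
  generalize (∏ m ∈ Finset.range k, d m) = P at *
  rw [abs_le] at hc
  -- These four entries, all of the sign of P, form twice the matrix in the basis of the edge
  -- vectors: αδ - βγ = 4 and the trace is (α + δ)/2. Since βγ > 0, αδ > 4, and AM-GM gives |trace|
  -- > 2.
  have hdet' : (A + 1 * B + (C + 1 * D)) * (A + -1 * B - (C + -1 * D))
      - (A + 1 * B - (C + 1 * D)) * (A + -1 * B + (C + -1 * D)) = 4 := by
    linear_combination 4 * hdet
  have htr : A + D = ((A + 1 * B + (C + 1 * D)) + (A + -1 * B - (C + -1 * D))) / 2 := by ring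
  rw [htr]
  generalize A + 1 * B + (C + 1 * D) = α at *
  generalize A + 1 * B - (C + 1 * D) = β at *
  generalize A + -1 * B + (C + -1 * D) = γ at *
  generalize A + -1 * B - (C + -1 * D) = δ at *
  rcases lt_trichotomy P 0 with hP | hP | hP
  · have k1 := neg_of_mul_pos_right h1 hP.le
    have k2 := neg_of_mul_pos_right h2 hP.le
    have k3 := neg_of_mul_pos_right h3 hP.le
    have k4 := neg_of_mul_pos_right h4 hP.le
    have := mul_pos_of_neg_of_neg k2 k3
    refine mul_pos_of_neg_of_neg hP ?_
    nlinarith [sq_nonneg (α - δ)]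
  · simp [hP] at h1
  · have k1 := pos_of_mul_pos_right h1 hP.le
    have k2 := pos_of_mul_pos_right h2 hP.le
    have k3 := pos_of_mul_pos_right h3 hP.le
    have k4 := pos_of_mul_pos_right h4 hP.le
    have := mul_pos k2 k3
    refine mul_pos hP ?_
    nlinarith [sq_nonneg (α - δ)]

end Cone

/-! ### The discriminant polynomial and its slope on the bands. -/

open Polynomial

/-- The discriminant of the period-`p` Jacobi recursion with potential `v`. -/
noncomputable def discriminant (v : ℤ → ℝ) (p : ℕ) : ℝ[X] :=
  (transferProd (fun m : ℕ => X - C (v m)) p).trace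

/-- The degree bounds must be proved together. The one on the last entry is loose, but it is exactly
what the `0 1` entry needs at the next step. -/
theorem transferProd_degree (v : ℕ → ℝ) (k : ℕ) :
    (transferProd (R := ℝ[X]) (fun m => X - C (v m)) k 0 0).Monic ∧
      (transferProd (R := ℝ[X]) (fun m => X - C (v m)) k 0 0).degree = (k : WithBot ℕ) ∧
      (transferProd (R := ℝ[X]) (fun m => X - C (v m)) k 0 1).degree < (k : WithBot ℕ) ∧
      (transferProd (R := ℝ[X]) (fun m => X - C (v m)) k 1 0).degree < (k : WithBot ℕ) ∧
      (transferProd (R := ℝ[X]) (fun m => X - C (v m)) k 1 1).degree < ((k + 1 : ℕ) : WithBot ℕ) := by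
  induction k with
  | zero => simp
  | succ k ih =>
    obtain ⟨h1, h2, h3, h4, h5⟩ := ih
    have hX (q : ℝ[X]) : ((X - C (v k)) * q).degree = 1 + q.degree := by
      rw [degree_mul, degree_X_sub_C]
    have hlt : (transferProd (R := ℝ[X]) (fun m => X - C (v m)) k 1 0).degree
        < ((X - C (v k)) * transferProd (R := ℝ[X]) (fun m => X - C (v m)) k 0 0).degree := by
      rw [hX, h2]
      refine h4.trans ?_
      rw [← Nat.cast_one, ← Nat.cast_add]
      exact_mod_cast (by omega : k < 1 + k)
    simp only [transferProd_succ_zero, transferProd_succ_one]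
    refine ⟨?_, ?_, ?_, ?_, ?_⟩
    · exact ((monic_X_sub_C _).mul h1).sub_of_left hlt
    · rw [degree_sub_eq_left_of_degree_lt hlt, hX, h2, Nat.cast_succ, add_comm]
    · refine (degree_sub_le _ _).trans_lt (max_lt ?_ h5)
      rw [hX, Nat.cast_succ, add_comm]
      exact WithBot.add_lt_add_right (by simp) h3
    · rw [h2]
      exact_mod_cast Nat.lt_succ_self k
    · exact h3.trans (by exact_mod_cast (by omega : k < k + 1 + 1))

theorem discriminant_monic_natDegree (v : ℤ → ℝ) {p : ℕ} (hp : p ≠ 0) :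
    (discriminant v p).Monic ∧ (discriminant v p).natDegree = p := by
  obtain ⟨k, rfl⟩ := Nat.exists_eq_succ_of_ne_zero hp
  obtain ⟨h1, h2, -, -, -⟩ := transferProd_degree (fun m => v m) (k + 1)
  obtain ⟨-, -, h3, -, -⟩ := transferProd_degree (fun m => v m) k
  have hlt : (transferProd (fun m : ℕ => X - C (v m)) (k + 1) 1 1).degree
      < (transferProd (fun m : ℕ => X - C (v m)) (k + 1) 0 0).degree := by
    rw [h2, transferProd_succ_one]
    exact h3.trans (by exact_mod_cast Nat.lt_succ_self k)
  rw [discriminant, Matrix.trace_fin_two]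
  refine ⟨h1.add_of_left hlt, natDegree_eq_of_degree_eq_some ?_⟩
  rw [degree_add_eq_left_of_degree_lt hlt, h2]

theorem eval_discriminant (v : ℤ → ℝ) (p : ℕ) (x : ℝ) :
    (discriminant v p).eval x = (transferProd (fun m : ℕ => x - v m) p).trace := by
  have h := map_transferProd (fun m : ℕ => X - C (v m)) (evalRingHom x) p
  simp only [coe_evalRingHom, eval_sub, eval_X, eval_C] at h
  simp only [discriminant, Matrix.trace_fin_two, eval_add, h]

theorem prod_mul_discriminant_sub_pos {v : ℤ → ℝ} {p : ℕ} (hp : p ≠ 0) {x c : ℝ}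
    (hx : ∀ m < p, 2 < |x - v m|) (hc : |c| ≤ 2) :
    0 < (∏ m ∈ Finset.range p, (x - v m)) * ((discriminant v p).eval x - c) := by
  rw [eval_discriminant]
  exact prod_mul_trace_sub_pos hp hx hc

/-- If the values of the potential are `g`-separated, every level `c ∈ [-2, 2]` of the discriminant
is attained near each of them. -/
theorem exists_root_near {v : ℤ → ℝ} {p : ℕ} (hp : p ≠ 0) {g r c : ℝ} (hr : 2 < r)
    (hg : r + 2 < g) (hv : ∀ j < p, ∀ k < p, j ≠ k → g ≤ |v j - v k|) (hc : |c| ≤ 2)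
    {j : ℕ} (hj : j < p) : ∃ x, |x - v j| ≤ r ∧ (discriminant v p).eval x = c := by
  have hout (s : ℝ) (hs : |s| = r) (m : ℕ) (hm : m < p) : 2 < |v j + s - v m| := by
    rcases eq_or_ne j m with rfl | hne
    · rwa [add_sub_cancel_left, hs]
    · have h1 := hv j hj m hm hne
      have h2 := abs_sub_abs_le_abs_sub (v j - v m) (-s)
      rw [abs_neg, hs, sub_neg_eq_add, sub_add_eq_add_sub] at h2
      linarith
  have hr' : |r| = r := abs_of_pos (by linarith)
  have h1 := prod_mul_discriminant_sub_pos hp (hout r hr') hc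
  have h2 := prod_mul_discriminant_sub_pos hp (hout (-r) (by rw [abs_neg, hr'])) hc
  -- Between v j - r and v j + r only the factor with index j changes sign, so the discriminant
  -- minus c changes sign as well.
  have hneg : (∏ m ∈ Finset.range p, (v j + r - v m)) * (∏ m ∈ Finset.range p, (v j + -r - v m))
      < 0 := by
    rw [← Finset.prod_mul_distrib,
      ← Finset.mul_prod_erase _ _ (Finset.mem_range.mpr hj)]
    refine mul_neg_of_neg_of_pos (by nlinarith) (Finset.prod_pos fun m hm => ?_)
    rw [Finset.mem_erase, Finset.mem_range] at hm
    have h3 := hv j hj m hm.2 hm.1.symm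
    have h4 : (v j + r - v m) * (v j + -r - v m) = |v j - v m| ^ 2 - r ^ 2 := by
      rw [sq_abs]
      ring
    rw [h4]
    nlinarith
  have hopp : ((discriminant v p).eval (v j + r) - c) * ((discriminant v p).eval (v j + -r) - c)
      < 0 := by
    by_contra! h
    nlinarith [mul_pos h1 h2]
  have hcont : ContinuousOn (fun x => (discriminant v p).eval x)
      (Set.uIcc (v j + -r) (v j + r)) := (discriminant v p).continuous.continuousOn
  have hmem : c ∈ Set.uIcc ((discriminant v p).eval (v j + -r))
      ((discriminant v p).eval (v j + r)) := by
    rw [Set.mem_uIcc]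
    rcases mul_neg_iff.mp hopp with h | h
    · left; constructor <;> linarith
    · right; constructor <;> linarith
  obtain ⟨x, hx, hxc⟩ := intermediate_value_uIcc hcont hmem
  rw [Set.uIcc_of_le (by linarith), Set.mem_Icc] at hx
  exact ⟨x, abs_le.mpr ⟨by linarith, by linarith⟩, hxc⟩

/-- One root of D = D(x) near each v j gives p distinct roots, hence all of them; x is one, and
D'(x) is the product of its differences with the other p - 1. -/
theorem le_abs_derivative_discriminant {v : ℤ → ℝ} {p : ℕ} (hp : p ≠ 0) {g r x : ℝ} (hr : 2 < r)
    (hg : r + 2 < g) (hg' : 2 * r < g) (hv : ∀ j < p, ∀ k < p, j ≠ k → g ≤ |v j - v k|)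
    (hx : |(discriminant v p).eval x| ≤ 2) :
    (g - 2 * r) ^ (p - 1) ≤ |(derivative (discriminant v p)).eval x| := by
  have hroot (j : ℕ) : ∃ y, j < p → |y - v j| ≤ r ∧
      (discriminant v p).eval y = (discriminant v p).eval x := by
    by_cases hj : j < p
    · obtain ⟨y, hy⟩ := exists_root_near hp hr hg hv hx hj
      exact ⟨y, fun _ => hy⟩
    · exact ⟨0, fun h => absurd h hj⟩
  choose y hy using hroot
  have hsep : ∀ j < p, ∀ k < p, j ≠ k → g - 2 * r ≤ |y j - y k| := by
    intro j hj k hk hjk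
    have h1 := hv j hj k hk hjk
    have h2 := (hy j hj).1
    have h3 := (hy k hk).1
    have h4 := abs_add_le (v j - y j) (y j - y k)
    have h5 := abs_add_le (v j - y j + (y j - y k)) (y k - v k)
    rw [abs_sub_comm (v j)] at h4
    have h6 : v j - y j + (y j - y k) + (y k - v k) = v j - v k := by ring
    rw [h6] at h5
    linarith
  have hinj : Set.InjOn y (Finset.range p) := by
    intro j hj k hk h
    by_contra hne
    have := hsep j (Finset.mem_range.mp hj) k (Finset.mem_range.mp hk) hne
    rw [h, sub_self, abs_zero] at this
    linarith
  obtain ⟨hmon, hdeg⟩ := discriminant_monic_natDegree v hp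
  have hD : discriminant v p
      = Lagrange.nodal (Finset.range p) y + C ((discriminant v p).eval x) := by
    have hdn : (Lagrange.nodal (Finset.range p) y + C ((discriminant v p).eval x)).Monic :=
      (Lagrange.nodal_monic).add_of_left (degree_C_le.trans_lt (by
        rw [Lagrange.degree_nodal, Finset.card_range]
        exact_mod_cast Nat.pos_of_ne_zero hp))
    have hnd : (discriminant v p).degree
        = (Lagrange.nodal (Finset.range p) y + C ((discriminant v p).eval x)).degree := by
      rw [degree_add_eq_left_of_degree_lt (degree_C_le.trans_lt (by
        rw [Lagrange.degree_nodal, Finset.card_range]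
        exact_mod_cast Nat.pos_of_ne_zero hp)), Lagrange.degree_nodal, Finset.card_range,
        degree_eq_natDegree hmon.ne_zero, hdeg]
    refine eq_of_degree_sub_lt_of_eval_index_eq (Finset.range p) hinj ?_ fun j hj => ?_
    · refine (degree_sub_lt_left hnd hmon.ne_zero (hmon.trans hdn.symm)).trans_le ?_
      rw [degree_eq_natDegree hmon.ne_zero, hdeg, Finset.card_range]
    · rw [(hy j (Finset.mem_range.mp hj)).2, eval_add, eval_C,
        Lagrange.eval_nodal_at_node hj, zero_add]
  have hxz : (Lagrange.nodal (Finset.range p) y).eval x = 0 := by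
    have h := congrArg (eval x) hD
    rw [eval_add, eval_C] at h
    linarith
  rw [Lagrange.eval_nodal, Finset.prod_eq_zero_iff] at hxz
  obtain ⟨i, hi, hxi⟩ := hxz
  rw [sub_eq_zero] at hxi
  rw [hD, derivative_add, derivative_C, add_zero, hxi,
    Lagrange.eval_nodal_derivative_eval_node_eq hi, Lagrange.eval_nodal, Finset.abs_prod]
  have hcard : ((Finset.range p).erase i).card = p - 1 := by
    rw [Finset.card_erase_of_mem hi, Finset.card_range]
  rw [← hcard, ← Finset.prod_const]
  refine Finset.prod_le_prod (fun _ _ => by linarith) fun k hk => ?_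
  rw [Finset.mem_erase, Finset.mem_range] at hk
  exact hsep i (Finset.mem_range.mp hi) k hk.2 hk.1.symm

/-! ### Calculus of bounded commutators with an unbounded multiplication. -/

/-- `A` represents the commutator `[w, T]` with the (possibly unbounded) multiplication by `w`:
on the domain of `w`, one has `w T = T w + A`. -/
def IsCommutator (w : ℤ → ℂ) (T A : EllTwo →L[ℂ] EllTwo) : Prop :=
  ∀ ψ φ : EllTwo, (∀ n, φ n = w n * ψ n) → ∀ n, (T φ + A ψ) n = w n * (T ψ) n

theorem ellTwo_eval_tendsto {ι : Type*} {l : Filter ι} {f : ι → EllTwo} {ψ : EllTwo}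
    (h : Tendsto f l (𝓝 ψ)) (n : ℤ) : Tendsto (fun i => f i n) l (𝓝 (ψ n)) := by
  rw [tendsto_iff_norm_sub_tendsto_zero] at h ⊢
  refine squeeze_zero (fun _ => norm_nonneg _) (fun i => ?_) h
  exact lp.norm_apply_le_norm (by norm_num) (f i - ψ) n

theorem eq_of_forall_delta {S T : EllTwo →L[ℂ] EllTwo} (h : ∀ n, S (delta n) = T (delta n)) :
    S = T := by
  ext1 ψ
  have h1 := (lp.hasSum_single (E := fun _ : ℤ => ℂ) (p := 2) (by norm_num) ψ)
  have h2 (n : ℤ) : lp.single (E := fun _ : ℤ => ℂ) 2 n (ψ n) = (ψ n) • delta n := by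
    rw [delta, ← lp.single_smul, smul_eq_mul, mul_one]
  simp only [h2] at h1
  have h3 := h1.mapL S
  have h4 := h1.mapL T
  simp only [map_smul, h] at h3 h4
  exact h3.unique h4

namespace IsCommutator

variable {w : ℤ → ℂ} {S T A B : EllTwo →L[ℂ] EllTwo}

theorem add (hS : IsCommutator w S A) (hT : IsCommutator w T B) :
    IsCommutator w (S + T) (A + B) := by
  intro ψ φ h n
  have h1 := hS ψ φ h n
  have h2 := hT ψ φ h n
  simp only [lp.coeFn_add, Pi.add_apply, add_apply] at h1 h2 ⊢
  linear_combination h1 + h2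

theorem smul (c : ℂ) (hS : IsCommutator w S A) : IsCommutator w (c • S) (c • A) := by
  intro ψ φ h n
  have h1 := hS ψ φ h n
  simp only [lp.coeFn_add, Pi.add_apply, smul_apply, lp.coeFn_smul,
    Pi.smul_apply, smul_eq_mul] at h1 ⊢
  linear_combination c * h1

theorem mul (hS : IsCommutator w S A) (hT : IsCommutator w T B) :
    IsCommutator w (S * T) (S * B + A * T) := by
  intro ψ φ h n
  have h2 := hS (T ψ) (T φ + B ψ) (hT ψ φ h) n
  change (S (T φ) + (S (B ψ) + A (T ψ))) n = w n * S (T ψ) n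
  simp only [lp.coeFn_add, Pi.add_apply, map_add] at h2 ⊢
  linear_combination h2

protected theorem one : IsCommutator w 1 0 := by
  intro ψ φ h n
  simpa using h n

theorem delta_mem (w : ℤ → ℂ) (m n : ℤ) : (w m • delta m) n = w n * delta m n := by
  rw [lp.coeFn_smul, Pi.smul_apply, smul_eq_mul]
  rcases eq_or_ne n m with rfl | h
  · rfl
  · rw [delta, lp.single_apply_ne _ _ _ h, mul_zero, mul_zero]

/-- Each basis vector lies in the domain of w, so the commutator is determined on a total set. -/
theorem unique (hA : IsCommutator w T A) (hB : IsCommutator w T B) : A = B := by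
  refine eq_of_forall_delta fun m => ?_
  have h := fun n => (hA _ _ (delta_mem w m) n).trans (hB _ _ (delta_mem w m) n).symm
  ext n
  have h1 := h n
  simp only [lp.coeFn_add, Pi.add_apply] at h1
  exact add_left_cancel h1

/-- Multiplication by w is closed: the identity passes to the limit coordinate by coordinate. -/
theorem hasSum {f g : ℕ → EllTwo →L[ℂ] EllTwo} (h : ∀ k, IsCommutator w (f k) (g k))
    (hf : HasSum f T) (hg : HasSum g A) : IsCommutator w T A := by
  have hfin (s : Finset ℕ) : IsCommutator w (∑ k ∈ s, f k) (∑ k ∈ s, g k) := by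
    induction s using Finset.cons_induction with
    | empty => intro ψ φ _ n; simp
    | cons k s hk ih => rw [Finset.sum_cons, Finset.sum_cons]; exact (h k).add ih
  have happ {F : Finset ℕ → EllTwo →L[ℂ] EllTwo} {L : EllTwo →L[ℂ] EllTwo}
      (hF : Tendsto F atTop (𝓝 L)) (ψ : EllTwo) : Tendsto (fun s => F s ψ) atTop (𝓝 (L ψ)) :=
    ((ContinuousLinearMap.apply ℂ EllTwo ψ).continuous.tendsto L).comp hF
  intro ψ φ hψ n
  have h1 := ellTwo_eval_tendsto ((happ hf φ).add (happ hg ψ)) n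
  have h2 := (ellTwo_eval_tendsto (happ hf ψ) n).const_mul (w n)
  refine tendsto_nhds_unique h1 (h2.congr fun s => ?_)
  exact (hfin s ψ φ hψ n).symm

/-- The commutator with a polynomial in `T` is `q'(T) [w, T]` up to a commutator with `T`. -/
theorem aeval (hT : IsCommutator w T A) (q : ℝ[X]) :
    ∃ K, IsCommutator w (Polynomial.aeval T q)
      (Polynomial.aeval T (derivative q) * A + (T * K - K * T)) := by
  induction q using Polynomial.induction_on with
  | C a =>
    refine ⟨0, ?_⟩
    have h : Polynomial.aeval T (C a) = (a : ℂ) • (1 : EllTwo →L[ℂ] EllTwo) := by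
      rw [aeval_C, Algebra.algebraMap_eq_smul_one]
      rfl
    rw [h]
    simpa using IsCommutator.one.smul (a : ℂ)
  | add q r hq hr =>
    obtain ⟨K, hK⟩ := hq
    obtain ⟨L, hL⟩ := hr
    refine ⟨K + L, ?_⟩
    have h := hK.add hL
    convert h using 1
    · rw [map_add]
    · rw [derivative_add, map_add]
      noncomm_ring
  | monomial n a ih =>
    obtain ⟨K, hK⟩ := ih
    have hc : Polynomial.aeval T (derivative (C a * X ^ n)) * T
        = T * Polynomial.aeval T (derivative (C a * X ^ n)) := by
      have h := congrArg (Polynomial.aeval T) (mul_comm (derivative (C a * X ^ n)) X)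
      rwa [map_mul (Polynomial.aeval T), map_mul (Polynomial.aeval T), aeval_X] at h
    -- Moving T past A turns q'(T) A T into q'(T) T A plus a commutator with T, which is absorbed
    -- into the new K.
    refine ⟨K * T - Polynomial.aeval T (derivative (C a * X ^ n)) * A, ?_⟩
    have h := hK.mul hT
    rw [pow_succ, ← mul_assoc, derivative_mul, derivative_X, mul_one,
      map_mul (Polynomial.aeval T) (C a * X ^ n), map_add,
      map_mul (Polynomial.aeval T) (derivative (C a * X ^ n)), aeval_X]
    convert h using 1
    rw [hc]
    noncomm_ring

/-- If `[w, Z] = Q + [K, Z]` with `Q` commuting with `Z`, then `[w, ·]` acts on powers of `Z` like a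
derivation. -/
theorem pow_succ' {Z Q K : EllTwo →L[ℂ] EllTwo} (hZ : IsCommutator w Z (Q + (K * Z - Z * K)))
    (hQ : Commute Q Z) (k : ℕ) :
    IsCommutator w (Z ^ (k + 1)) ((k + 1 : ℂ) • (Z ^ k * Q) + (K * Z ^ (k + 1) - Z ^ (k + 1) * K)) := by
  induction k with
  | zero => simpa using hZ
  | succ k ih =>
    have h := ih.mul hZ
    have hc : Z ^ k * Q * Z = Z ^ k * Z * Q := by rw [mul_assoc, hQ.eq, mul_assoc]
    rw [pow_succ Z (k + 1)]
    convert h using 1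
    rw [add_mul, smul_mul_assoc, hc, ← pow_succ, Nat.cast_succ, add_smul _ (1 : ℂ), one_smul]
    noncomm_ring

theorem exp {Z Q K : EllTwo →L[ℂ] EllTwo} (hZ : IsCommutator w Z (Q + (K * Z - Z * K)))
    (hQ : Commute Q Z) :
    IsCommutator w (NormedSpace.exp Z)
      (NormedSpace.exp Z * Q + (K * NormedSpace.exp Z - NormedSpace.exp Z * K)) := by
  have hs := NormedSpace.exp_series_hasSum_exp' (𝕂 := ℂ) Z
  -- Differentiating the exponential series shifts it by one index, so the term of index 0 vanishes.
  let g : ℕ → EllTwo →L[ℂ] EllTwo := fun k => match k with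
    | 0 => 0
    | k + 1 => ((k.factorial : ℂ)⁻¹ • Z ^ k) * Q
  have hg : HasSum g (NormedSpace.exp Z * Q) := by
    rw [← hasSum_nat_add_iff' 1]
    simpa [g] using hs.mul_right Q
  refine hasSum (f := fun k => ((k.factorial : ℂ)⁻¹) • Z ^ k)
    (g := fun k => g k + (K * ((k.factorial : ℂ)⁻¹ • Z ^ k) - ((k.factorial : ℂ)⁻¹ • Z ^ k) * K))
    (fun k => ?_) hs (hg.add ((hs.mul_left K).sub (hs.mul_right K)))
  cases k with
  | zero => simpa [g] using IsCommutator.one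
  | succ k =>
    have h := (hZ.pow_succ' hQ k).smul (((k + 1).factorial : ℂ)⁻¹)
    convert h using 1
    have hk : ((k + 1).factorial : ℂ)⁻¹ * (k + 1) = (k.factorial : ℂ)⁻¹ := by
      rw [Nat.factorial_succ]
      push_cast
      have h1 : (k : ℂ) + 1 ≠ 0 := by exact_mod_cast k.succ_ne_zero
      have h2 : (k.factorial : ℂ) ≠ 0 := by exact_mod_cast k.factorial_ne_zero
      field_simp
    simp only [g, smul_add, smul_sub, smul_smul, hk, mul_smul_comm, smul_mul_assoc]

end IsCommutator

/-! ### The periodic Hamiltonian, its discriminant and the velocity operator. -/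

@[simp] theorem shift_apply (k : ℤ) (ψ : EllTwo) (n : ℤ) : shift k ψ n = ψ (n + k) := rfl

@[simp] theorem potentialOp_apply (V : ℤ → ℝ) (hV : ∃ C : ℝ, ∀ n, |V n| ≤ C) (ψ : EllTwo) (n : ℤ) :
    potentialOp V hV ψ n = V n * ψ n := rfl

theorem delta_apply (m n : ℤ) : delta m n = if n = m then 1 else 0 := by
  rw [delta, lp.single_apply, Pi.single_apply]

theorem norm_delta (n : ℤ) : ‖delta n‖ = 1 := by
  rw [delta, lp.norm_single (by norm_num), norm_one]

theorem shift_delta (k m : ℤ) : shift k (delta m) = delta (m - k) := by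
  ext n
  rw [shift_apply, delta_apply, delta_apply]
  simp only [eq_sub_iff_add_eq]

theorem norm_shift_le (k : ℤ) : ‖shift k‖ ≤ 1 :=
  LinearMap.mkContinuous_norm_le _ zero_le_one _

theorem isCommutator_shift {w : ℤ → ℂ} {k : ℤ} {A : EllTwo →L[ℂ] EllTwo}
    (hA : ∀ ψ n, A ψ n = (w n - w (n + k)) * ψ (n + k)) : IsCommutator w (shift k) A := by
  intro ψ φ h n
  rw [lp.coeFn_add, Pi.add_apply, hA, shift_apply, shift_apply, h]
  ring

theorem isCommutator_potentialOp (w : ℤ → ℂ) (V : ℤ → ℝ) (hV : ∃ C : ℝ, ∀ n, |V n| ≤ C) :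
    IsCommutator w (potentialOp V hV) 0 := by
  intro ψ φ h n
  simp only [zero_apply, add_zero, potentialOp_apply, h]
  ring

theorem exists_isCommutator_shift {w : ℤ → ℝ} {k : ℤ} (hw : ∃ C : ℝ, ∀ n, |w n - w (n + k)| ≤ C) :
    ∃ A, IsCommutator (fun n => (w n : ℂ)) (shift k) A :=
  ⟨potentialOp _ hw * shift k, isCommutator_shift fun ψ n => by
    change ((w n - w (n + k) : ℝ) : ℂ) * ψ (n + k) = _
    rw [Complex.ofReal_sub]⟩

theorem abs_cell_sub_le {p : ℕ} (hp : 0 < p) (n : ℤ) :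
    |((n / (p : ℤ) : ℤ) : ℝ) - ((n + 1) / (p : ℤ) : ℤ)| ≤ 1 := by
  have hp0 : (0 : ℤ) < p := by exact_mod_cast hp
  have h1 : n / (p : ℤ) ≤ (n + 1) / p := Int.ediv_le_ediv hp0 (by omega)
  have h2 : (n + 1) / (p : ℤ) ≤ (n + p) / p := Int.ediv_le_ediv hp0 (by omega)
  rw [Int.add_ediv_of_dvd_right (dvd_refl _), Int.ediv_self hp0.ne'] at h2
  rw [← Int.cast_sub, ← Int.cast_abs]
  have h3 : |n / (p : ℤ) - (n + 1) / p| ≤ 1 := abs_le.mpr ⟨by omega, by omega⟩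
  exact_mod_cast h3

/-- The commutator of the cell index with the Hamiltonian is bounded. -/
theorem exists_isCommutator_hamiltonian {p : ℕ} (hp : 0 < p) (V : ℤ → ℝ)
    (hV : ∃ C : ℝ, ∀ n, |V n| ≤ C) (μ : ℝ) :
    ∃ A, IsCommutator (fun n => ((n / (p : ℤ) : ℤ) : ℂ)) (hamiltonian V hV μ) A := by
  obtain ⟨A, hA⟩ := exists_isCommutator_shift (w := fun n => ((n / (p : ℤ) : ℤ) : ℝ)) (k := 1)
    ⟨1, abs_cell_sub_le hp⟩
  obtain ⟨B, hB⟩ := exists_isCommutator_shift (w := fun n => ((n / (p : ℤ) : ℤ) : ℝ)) (k := -1)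
    ⟨1, fun n => by
      have h := abs_cell_sub_le hp (n + -1)
      rwa [neg_add_cancel_right, abs_sub_comm] at h⟩
  simp only [Complex.ofReal_intCast] at hA hB
  exact ⟨_, (hA.add hB).add ((isCommutator_potentialOp _ V hV).smul μ)⟩

/-- A translation by one period changes the cell index by exactly one. -/
theorem isCommutator_translation {p : ℕ} (hp : 0 < p) :
    IsCommutator (fun n => ((n / (p : ℤ) : ℤ) : ℂ)) (shift p + shift (-p))
      (shift (-p) - shift p) := by
  have hp0 : (p : ℤ) ≠ 0 := by exact_mod_cast hp.ne'
  have h1 : IsCommutator (fun n => ((n / (p : ℤ) : ℤ) : ℂ)) (shift p) (-shift p) :=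
    isCommutator_shift fun ψ n => by
      rw [Int.add_ediv_of_dvd_right (dvd_refl _), Int.ediv_self hp0]
      simp
  have h2 : IsCommutator (fun n => ((n / (p : ℤ) : ℤ) : ℂ)) (shift (-p)) (shift (-p)) :=
    isCommutator_shift fun ψ n => by
      rw [Int.add_ediv_of_dvd_right (dvd_neg.mpr (dvd_refl _)),
        Int.ediv_eq_of_eq_mul_right hp0 (by ring : -(p : ℤ) = p * (-1))]
      simp
  rw [sub_eq_neg_add]
  exact h1.add h2

theorem shift_isSelfAdjoint : IsSelfAdjoint (shift 1 + shift (-1)) := by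
  have h (k : ℤ) : ContinuousLinearMap.adjoint (shift k) = shift (-k) := by
    refine ((ContinuousLinearMap.eq_adjoint_iff _ _).mpr fun x y => ?_).symm
    rw [lp.inner_eq_tsum, lp.inner_eq_tsum, ← (Equiv.addRight k).tsum_eq]
    refine tsum_congr fun n => ?_
    simp
  rw [IsSelfAdjoint, ContinuousLinearMap.star_eq_adjoint, map_add, h, h, neg_neg, add_comm]

theorem hamiltonian_isSelfAdjoint (V : ℤ → ℝ) (hV : ∃ C : ℝ, ∀ n, |V n| ≤ C) (μ : ℝ) :
    IsSelfAdjoint (hamiltonian V hV μ) := by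
  refine shift_isSelfAdjoint.add (.smul ?_ ?_)
  · simp [IsSelfAdjoint]
  · rw [IsSelfAdjoint, ContinuousLinearMap.star_eq_adjoint]
    refine ((ContinuousLinearMap.eq_adjoint_iff _ _).mpr fun x y => ?_).symm
    rw [lp.inner_eq_tsum, lp.inner_eq_tsum]
    refine tsum_congr fun n => ?_
    simp only [potentialOp_apply, RCLike.inner_apply, map_mul, Complex.conj_ofReal]
    ring

/-- The discriminant of a periodic Hamiltonian is the sum of the two period translations. -/
theorem aeval_discriminant {p : ℕ} {V : ℤ → ℝ} (hV : ∃ C : ℝ, ∀ n, |V n| ≤ C)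
    (hper : Function.Periodic V (p : ℤ)) (μ : ℝ) :
    aeval (hamiltonian V hV μ) (discriminant (fun n => μ * V n) p) = shift p + shift (-p) := by
  -- With X acting as H, the basis vectors satisfy δ_{n+1} = (X - μV_n)δ_n - δ_{n-1}, so the trace
  -- identity over ℝ[X] applies.
  let _ : Module ℝ[X] EllTwo := Module.compHom EllTwo (aeval (hamiltonian V hV μ)).toRingHom
  have hsmul (q : ℝ[X]) (ψ : EllTwo) : q • ψ = aeval (hamiltonian V hV μ) q ψ := rfl
  refine eq_of_forall_delta fun n => ?_
  have h := add_translates_eq_trace_smul (a := fun n => X - C (μ * V n)) (p := p)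
    (fun n => by simp only [hper n]) (e := delta) (fun n => ?_) n
  · rw [add_apply, shift_delta, shift_delta, sub_neg_eq_add, add_comm, h]
    rfl
  · rw [hsmul, map_sub, aeval_X, aeval_C, sub_apply]
    ext m
    have hC : (algebraMap ℝ (EllTwo →L[ℂ] EllTwo) (μ * V n)) (delta n)
        = ((μ * V n : ℝ) : ℂ) • delta n := by
      rw [Algebra.algebraMap_eq_smul_one]
      rfl
    rw [hC]
    simp only [lp.coeFn_sub, Pi.sub_apply, hamiltonian_apply, lp.coeFn_smul, Pi.smul_apply,
      delta_apply, smul_eq_mul]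
    rcases eq_or_ne m n with rfl | h0
    · have e1 : m ≠ m - 1 := by omega
      simp [e1]
    · have e1 : m + 1 = n ↔ m = n - 1 := by omega
      have e2 : m - 1 = n ↔ m = n + 1 := by omega
      simp [h0, e1, e2]

/-- Spectral points of a periodic Hamiltonian lie where the discriminant is at most `2`. -/
theorem abs_discriminant_le_of_mem_spectrum {p : ℕ} {V : ℤ → ℝ} (hV : ∃ C : ℝ, ∀ n, |V n| ≤ C)
    (hper : Function.Periodic V (p : ℤ)) (μ : ℝ) {x : ℝ}
    (hx : x ∈ spectrum ℝ (hamiltonian V hV μ)) :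
    |(discriminant (fun n => μ * V n) p).eval x| ≤ 2 := by
  have : Nontrivial EllTwo := ⟨⟨delta 0, 0, fun h => by
    have := norm_delta 0
    rw [h, norm_zero] at this
    exact zero_ne_one this⟩⟩
  have h1 : (discriminant (fun n => μ * V n) p).eval x
      ∈ spectrum ℝ (aeval (hamiltonian V hV μ) (discriminant (fun n => μ * V n) p)) :=
    spectrum.subset_polynomial_aeval _ _ ⟨x, hx, rfl⟩
  rw [aeval_discriminant hV hper] at h1
  have h2 := spectrum.norm_le_norm_of_mem h1
  rw [Real.norm_eq_abs] at h2
  have h3 := norm_add_le (shift p) (shift (-p))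
  have h4 := norm_shift_le p
  have h5 := norm_shift_le (-p)
  linarith

/-- A polynomial that is bounded below by `b` on the spectrum of a self-adjoint element has at it
an inverse of norm at most `b⁻¹`, commuting with the element. -/
theorem exists_inverse_aeval {𝔄 : Type*} [CStarAlgebra 𝔄] {H : 𝔄} (hH : IsSelfAdjoint H) (q : ℝ[X]) {b : ℝ}
    (hb : 0 < b) (hq : ∀ x ∈ spectrum ℝ H, b ≤ |q.eval x|) :
    ∃ G : 𝔄, G * aeval H q = 1 ∧ Commute G H ∧ ‖G‖ ≤ b⁻¹ := by
  have hne : ∀ x ∈ spectrum ℝ H, q.eval x ≠ 0 := fun x hx h0 => by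
    have := hq x hx
    rw [h0, abs_zero] at this
    linarith
  have hcont : ContinuousOn (fun x => (q.eval x)⁻¹) (spectrum ℝ H) :=
    q.continuous.continuousOn.inv₀ hne
  refine ⟨cfc (fun x => (q.eval x)⁻¹) H, ?_, ?_, ?_⟩
  · rw [← cfc_polynomial q H hH, ← cfc_mul _ _ H hcont q.continuous.continuousOn,
      ← cfc_one ℝ H hH]
    exact cfc_congr fun x hx => inv_mul_cancel₀ (hne x hx)
  · have h := cfc_commute_cfc (fun x => (q.eval x)⁻¹) (id : ℝ → ℝ) H
    rwa [cfc_id ℝ H hH] at h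
  · refine norm_cfc_le (by positivity) fun x hx => ?_
    rw [norm_inv, Real.norm_eq_abs]
    exact inv_anti₀ hb (hq x hx)

theorem commute_shift_hamiltonian {V : ℤ → ℝ} (hV : ∃ C : ℝ, ∀ n, |V n| ≤ C) {k : ℤ}
    (hper : Function.Periodic V k) (μ : ℝ) : Commute (shift k) (hamiltonian V hV μ) := by
  ext ψ n
  change hamiltonian V hV μ ψ (n + k) = hamiltonian V hV μ (shift k ψ) n
  rw [hamiltonian_apply, hamiltonian_apply, hper n]
  simp only [shift_apply]
  rw [add_right_comm n, sub_add_eq_add_sub]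

/-- Since G commutes with H, left multiplication by G sends commutators with H to commutators with
H. -/
theorem eq_add_commutator_of_inverse {R : Type*} [Ring R] {H q G B A K : R}
    (hGq : G * q = 1) (hGH : Commute G H) (h : q * A + (H * K - K * H) = B) :
    A = G * B + (G * K * H - H * (G * K)) := by
  have h1 : G * B = A + (H * (G * K) - G * K * H) := by
    rw [← h, mul_add, ← mul_assoc, hGq, one_mul, mul_sub, ← mul_assoc, hGH.eq]
    noncomm_ring
  rw [h1]
  abel

/-- The asymptotic velocity operator: `[Y, H] = Q + [K, H]` with `Q` commuting with `H`. -/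
theorem exists_velocity {p : ℕ} (hp : 0 < p) {V : ℤ → ℝ} (hV : ∃ C : ℝ, ∀ n, |V n| ≤ C)
    (hper : Function.Periodic V (p : ℤ)) (μ : ℝ) {b : ℝ} (hb : 0 < b)
    (hq : ∀ x, |(discriminant (fun n => μ * V n) p).eval x| ≤ 2 →
      b ≤ |(derivative (discriminant (fun n => μ * V n) p)).eval x|) :
    ∃ Q K, IsCommutator (fun n => ((n / (p : ℤ) : ℤ) : ℂ)) (hamiltonian V hV μ)
        (Q + (K * hamiltonian V hV μ - hamiltonian V hV μ * K)) ∧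
      Commute Q (hamiltonian V hV μ) ∧ ‖Q‖ ≤ 2 / b := by
  obtain ⟨A, hA⟩ := exists_isCommutator_hamiltonian hp V hV μ
  obtain ⟨K, hK⟩ := hA.aeval (discriminant (fun n => μ * V n) p)
  rw [aeval_discriminant hV hper] at hK
  obtain ⟨G, hG, hGH, hGn⟩ := exists_inverse_aeval (hamiltonian_isSelfAdjoint V hV μ)
    (derivative (discriminant (fun n => μ * V n) p)) hb
    fun x hx => hq x (abs_discriminant_le_of_mem_spectrum hV hper μ hx)
  -- The two expressions for the commutator with D(H) agree by uniqueness.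
  have hA' := eq_add_commutator_of_inverse hG hGH (hK.unique (isCommutator_translation hp))
  refine ⟨G * (shift (-p) - shift p), G * K, hA' ▸ hA, ?_, ?_⟩
  · exact hGH.mul_left ((commute_shift_hamiltonian hV hper.neg μ).sub_left
      (commute_shift_hamiltonian hV hper μ))
  · have h3 := norm_sub_le (shift (-p)) (shift p)
    have h4 := norm_shift_le p
    have h5 := norm_shift_le (-p)
    calc ‖G * (shift (-p) - shift p)‖ ≤ ‖G‖ * ‖shift (-p) - shift p‖ := norm_mul_le _ _
      _ ≤ b⁻¹ * 2 := by gcongr; linarith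
      _ = 2 / b := by ring

/-! ### Unitary evolution and ballistic motion. -/

theorem norm_timeEvolution {H : EllTwo →L[ℂ] EllTwo} (hH : IsSelfAdjoint H) (t : ℝ) (ψ : EllTwo) :
    ‖timeEvolution H t ψ‖ = ‖ψ‖ := by
  have h1 : -(Complex.I * (t : ℂ)) • H ∈ skewAdjoint (EllTwo →L[ℂ] EllTwo) := by
    rw [skewAdjoint.mem_iff, star_smul, hH.star_eq, ← neg_smul]
    simp
  let +nondep : NormedAlgebra ℚ (EllTwo →L[ℂ] EllTwo) := .restrictScalars ℚ ℂ _
  have h2 := NormedSpace.exp_mem_unitary_of_mem_skewAdjoint h1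
  exact ContinuousLinearMap.norm_map_of_mem_unitary h2 ψ

theorem smul_add_commutator {R : Type*} [Ring R] [Algebra ℂ R] (c : ℂ) (Q K H : R) :
    c • (Q + (K * H - H * K)) = c • Q + (K * (c • H) - (c • H) * K) := by
  rw [smul_add, smul_sub, mul_smul_comm, smul_mul_assoc]

/-- The norm does not see the sign of the cell index, so the signed index, whose commutators with
period translations are exact, can replace its absolute value. -/
theorem norm_position {p : ℕ} {ψ φ : EllTwo} (h : ∀ n, φ n = ((n / (p : ℤ) : ℤ) : ℂ) * ψ n) :
    ∃ hψ : ψ ∈ (position p).domain, ‖position p ⟨ψ, hψ⟩‖ = ‖φ‖ := by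
  have hn (n : ℤ) : ‖(cellDistance p n : ℂ) * ψ n‖ = ‖φ n‖ := by
    rw [h, norm_mul, norm_mul, cellDistance, Complex.norm_intCast, Complex.norm_intCast,
      Int.cast_abs, abs_abs]
  have hψ : Memℓp (fun n : ℤ => (cellDistance p n : ℂ) * ψ n) 2 := by
    refine memℓp_gen ?_
    simp only [hn]
    exact (lp.memℓp φ).summable (by norm_num)
  refine ⟨hψ, ?_⟩
  refine le_antisymm (lp.norm_mono (by norm_num) fun n => (hn n).le)
    (lp.norm_mono (by norm_num) fun n => (hn n).ge)

/-- If the commutator with the cell index is `Q` up to a commutator, ballistic motion has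
velocity `‖Q δ₀‖`. -/
theorem exists_tendsto_velocity {p : ℕ} {H Q K : EllTwo →L[ℂ] EllTwo} (hH : IsSelfAdjoint H)
    (hc : IsCommutator (fun n => ((n / (p : ℤ) : ℤ) : ℂ)) H (Q + (K * H - H * K)))
    (hQ : Commute Q H) :
    ∃ hX : ∀ t : ℝ, timeEvolution H t (delta 0) ∈ (position p).domain,
      Tendsto (fun t : ℝ => (1 / t) * ‖position p ⟨_, hX t⟩‖) atTop (𝓝 ‖Q (delta 0)‖) := by
  -- The site 0 lies in cell 0, so the signed position kills δ₀ and only the commutator term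
  -- survives.
  have h0 (n : ℤ) : (0 : EllTwo) n = ((n / (p : ℤ) : ℤ) : ℂ) * delta 0 n := by
    rw [delta_apply]
    split_ifs with h
    · simp [h]
    · simp
  have hU (t : ℝ) : IsCommutator (fun n => ((n / (p : ℤ) : ℤ) : ℂ)) (timeEvolution H t)
      (timeEvolution H t * (-(Complex.I * (t : ℂ)) • Q)
        + (K * timeEvolution H t - timeEvolution H t * K)) := by
    refine IsCommutator.exp ?_ ((hQ.smul_left _).smul_right _)
    rw [← smul_add_commutator]
    exact hc.smul _
  have hpos (t : ℝ) := norm_position fun n => (hU t _ _ h0 n)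
  choose hX hnorm using hpos
  refine ⟨hX, ?_⟩
  have hmain (t : ℝ) (ht : 0 < t) :
      |‖position p ⟨_, hX t⟩‖ - t * ‖Q (delta 0)‖| ≤ 2 * ‖K‖ := by
    rw [hnorm, map_zero, zero_add]
    have h1 : ‖timeEvolution H t ((-(Complex.I * (t : ℂ))) • Q (delta 0))‖
        = t * ‖Q (delta 0)‖ := by
      rw [norm_timeEvolution hH, norm_smul, norm_neg, norm_mul, Complex.norm_I, one_mul,
        Complex.norm_real, Real.norm_of_nonneg ht.le]
    rw [← h1]
    refine (abs_norm_sub_norm_le _ _).trans ?_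
    have h2 : (timeEvolution H t * (-(Complex.I * (t : ℂ)) • Q)
          + (K * timeEvolution H t - timeEvolution H t * K)) (delta 0)
        - timeEvolution H t ((-(Complex.I * (t : ℂ))) • Q (delta 0))
        = K (timeEvolution H t (delta 0)) - timeEvolution H t (K (delta 0)) :=
      add_sub_cancel_left _ _
    rw [h2]
    refine (norm_sub_le _ _).trans ?_
    have h3 := K.le_opNorm (timeEvolution H t (delta 0))
    have h4 := K.le_opNorm (delta 0)
    rw [norm_timeEvolution hH, norm_delta] at h3
    rw [norm_delta] at h4
    rw [norm_timeEvolution hH]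
    linarith
  rw [tendsto_iff_norm_sub_tendsto_zero]
  refine squeeze_zero' (g := fun t : ℝ => 2 * ‖K‖ * t⁻¹) (Eventually.of_forall fun _ => norm_nonneg _)
    ?_ (by simpa using tendsto_inv_atTop_zero.const_mul (2 * ‖K‖))
  filter_upwards [eventually_gt_atTop 0] with t ht
  have h1 : (1 / t) * ‖position p ⟨_, hX t⟩‖ - ‖Q (delta 0)‖
      = t⁻¹ * (‖position p ⟨_, hX t⟩‖ - t * ‖Q (delta 0)‖) := by
    field_simp
  rw [h1, norm_mul, norm_inv, Real.norm_of_nonneg ht.le, mul_comm]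
  exact mul_le_mul_of_nonneg_right (hmain t ht) (by positivity)

/-! ### Numerical consequences of the coupling threshold. -/

section Constants

theorem two_mul_hatC_le_sq {η₀ γ Γ μ : ℝ} {p : ℕ} (hμ : couplingThreshold η₀ γ Γ p ≤ μ) :
    0 < μ ∧ 2 * hatC η₀ γ Γ p * (2 / γ) ^ p ≤ μ ^ 2 := by
  have h1 : 1 ≤ couplingThreshold η₀ γ Γ p := Real.one_le_sqrt.mpr (le_max_left _ _)
  refine ⟨by linarith, ?_⟩
  exact (le_max_right _ _).trans ((Real.sqrt_le_left (by linarith)).mp hμ)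

/-- For p = 2 the middle term of Ĉ is 1 and 2e^{η₀} ≥ 2, so Ĉ ≥ 3 and (μγ)² ≥ 24 > 4.8². -/
theorem mul_gap_large_of_eq_two {η₀ γ Γ μ : ℝ} (hη₀ : 0 < η₀) (hγ : 0 < γ)
    (hμ : couplingThreshold η₀ γ Γ 2 ≤ μ) : 4.8 ≤ μ * γ := by
  obtain ⟨h0, h1⟩ := two_mul_hatC_le_sq hμ
  have h2 : 3 ≤ hatC η₀ γ Γ 2 := by
    have h3 : 1 ≤ Real.exp η₀ := Real.one_le_exp hη₀.le
    have h4 : 0 < 1 / (2 * Real.exp η₀) := by positivity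
    have h5 : 0 ≤ (Γ + γ / 2) ^ 2 := sq_nonneg _
    rw [hatC]
    rw [Nat.sub_self, pow_zero]
    linarith
  have h3 : (2 / γ) ^ 2 * γ ^ 2 = 4 := by field_simp; norm_num
  have h4 : 24 ≤ (μ * γ) ^ 2 := by
    have := mul_le_mul_of_nonneg_right h1 (sq_nonneg γ)
    rw [mul_assoc, h3] at this
    rw [mul_pow]
    linarith
  have := mul_pos h0 hγ
  nlinarith

/-- The first two terms of Ĉ suffice: one controls large γ, the other small γ, and the estimate
reduces to the exponent p = 3. -/
theorem mul_gap_large {η₀ γ Γ μ : ℝ} {p : ℕ} (hp : 3 ≤ p) (hγ : 0 < γ) (hΓ : γ ≤ Γ)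
    (hμ : couplingThreshold η₀ γ Γ p ≤ μ) : 9 ≤ μ * γ := by
  obtain ⟨h0, h1⟩ := two_mul_hatC_le_sq hμ
  obtain ⟨m, rfl⟩ : ∃ m, p = m + 1 + 2 := ⟨p - 3, by omega⟩
  have h2 : (3 * γ) ^ (m + 1 + 2) + (3 / 2 * γ + 2) ^ (m + 1) ≤ hatC η₀ γ Γ (m + 1 + 2) := by
    have h3 : 0 < Real.exp η₀ := Real.exp_pos _
    have h4 : 0 < 1 / (2 * Real.exp η₀) := by positivity
    have h5 : (3 * γ) ^ (m + 1 + 2) ≤ 2 ^ (m + 1 + 2) * (Γ + γ / 2) ^ (m + 1 + 2) := by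
      rw [← mul_pow]
      exact pow_le_pow_left₀ (by positivity) (by linarith) _
    have h6 : (3 / 2 * γ + 2) ^ (m + 1) ≤ (Γ + γ / 2 + 2) ^ (m + 1 + 2 - 2) := by
      rw [Nat.add_sub_cancel]
      exact pow_le_pow_left₀ (by positivity) (by linarith) _
    rw [hatC]
    linarith
  have h3 : ((3 * γ) ^ (m + 1 + 2) + (3 / 2 * γ + 2) ^ (m + 1)) * (2 / γ) ^ (m + 1 + 2) * γ ^ 2
      = 6 ^ (m + 1 + 2) * γ ^ 2 + 4 * (3 + 4 / γ) ^ (m + 1) := by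
    have e1 : (3 * γ) ^ (m + 1 + 2) * (2 / γ) ^ (m + 1 + 2) = 6 ^ (m + 1 + 2) := by
      rw [← mul_pow]
      congr 1
      field_simp
      norm_num
    have e2 : (3 / 2 * γ + 2) ^ (m + 1) * (2 / γ) ^ (m + 1) = (3 + 4 / γ) ^ (m + 1) := by
      rw [← mul_pow]
      congr 1
      field_simp
      ring
    have e3 : (2 / γ) ^ 2 * γ ^ 2 = 4 := by field_simp; norm_num
    rw [← e1, ← e2, ← e3, pow_add (2 / γ) (m + 1) 2]
    ring
  have h4 : 6 ^ 3 * γ ^ 2 + 4 * (3 + 4 / γ)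
      ≤ 6 ^ (m + 1 + 2) * γ ^ 2 + 4 * (3 + 4 / γ) ^ (m + 1) := by
    have h5 : 3 + 4 / γ ≤ (3 + 4 / γ) ^ (m + 1) :=
      le_self_pow₀ (by have : 0 < 4 / γ := by positivity
                       linarith) (by omega)
    have h6 : (6 : ℝ) ^ 3 ≤ 6 ^ (m + 1 + 2) := pow_le_pow_right₀ (by norm_num) (by omega)
    gcongr
  -- AM-GM for 27γ², 1/γ, 1/γ, with equality at γ = 1/3.
  have h5 : 9 ≤ 27 * γ ^ 2 + 2 / γ := by
    have h6 : 27 * γ ^ 2 + 2 / γ - 9 = (3 * γ - 1) ^ 2 * (3 * γ + 2) / γ := by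
      field_simp
      ring
    have h7 : 0 ≤ (3 * γ - 1) ^ 2 * (3 * γ + 2) / γ := by positivity
    linarith
  have h6 : 81 ≤ (μ * γ) ^ 2 := by
    have h7 := mul_le_mul_of_nonneg_right h1 (sq_nonneg γ)
    have h8 : ((3 * γ) ^ (m + 1 + 2) + (3 / 2 * γ + 2) ^ (m + 1)) * (2 / γ) ^ (m + 1 + 2) * γ ^ 2
        ≤ hatC η₀ γ Γ (m + 1 + 2) * (2 / γ) ^ (m + 1 + 2) * γ ^ 2 := by gcongr
    have h9 : 4 / γ = 2 * (2 / γ) := by ring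
    rw [mul_pow]
    linarith
  have := mul_pos h0 hγ
  nlinarith

/-- The bound on the velocity coming from the gap `μ γ` agrees with the claimed constant. -/
theorem two_div_gap_pow_le {η₀ γ Γ μ : ℝ} {p : ℕ} (hp : 2 ≤ p) (hη₀ : 0 < η₀) (hγ : 0 < γ)
    (hΓ : γ ≤ Γ) (hμ : couplingThreshold η₀ γ Γ p ≤ μ) :
    9 / 2 < μ * γ ∧ 2 / (μ * γ - 9 / 2) ^ (p - 1)
      ≤ (4 * Real.pi * (p : ℝ) ^ 2 * (2 / γ) ^ (p - 1)) / μ ^ (p - 1) := by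
  have h0 := (two_mul_hatC_le_sq hμ).1
  have hpi := Real.pi_gt_three
  -- For p = 2 the factor π p² absorbs the small margin 4.8 - 4.5; for p ≥ 3, μγ ≥ 9 gives μγ - 9/2
  -- ≥ μγ/2.
  rcases hp.eq_or_lt with rfl | hp3
  · have h1 := mul_gap_large_of_eq_two hη₀ hγ hμ
    norm_num at h1
    refine ⟨by linarith, ?_⟩
    have h2 : 0 < μ * γ - 9 / 2 := by linarith
    have h3 : (4 * Real.pi * ((2 : ℕ) : ℝ) ^ 2 * (2 / γ) ^ (2 - 1)) / μ ^ (2 - 1)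
        = 32 * Real.pi / (μ * γ) := by
      norm_num
      field_simp
      norm_num
    rw [h3, Nat.add_sub_cancel (n := 1) (m := 1), pow_one, div_le_div_iff₀ h2 (mul_pos h0 hγ)]
    nlinarith
  · have h1 := mul_gap_large hp3 hγ hΓ hμ
    refine ⟨by linarith, ?_⟩
    have h2 : 0 < μ * γ / 2 := by positivity
    have h3 : (2 / γ) ^ (p - 1) / μ ^ (p - 1) = 1 / (μ * γ / 2) ^ (p - 1) := by
      rw [← div_pow, ← one_div_pow]
      congr 1
      field_simp
    rw [mul_div_assoc, h3, mul_one_div]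
    have h4 : (3 : ℝ) ≤ p := by exact_mod_cast hp3
    have h5 : 2 ≤ 4 * Real.pi * (p : ℝ) ^ 2 := by nlinarith
    gcongr
    linarith

end Constants

/-! ### Assembly. -/

theorem theorem2 (p : ℕ) (hp : 2 ≤ p) (V : ℤ → ℝ) (hV : Function.Periodic V (p : ℤ))
    (γ Γ : ℝ) (hγ : IsLeast (potentialDifferences p V) γ) (hγ0 : 0 < γ)
    (hΓ : IsGreatest (potentialDifferences p V) Γ)
    (η₀ : ℝ) (hη₀ : 0 < η₀) (μ : ℝ) (hμ : couplingThreshold η₀ γ Γ p ≤ μ) :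
    ∃ hX : ∀ t : ℝ, timeEvolution (hamiltonian V (periodic_bounded hp hV) μ) t (delta 0) ∈
        (position p).domain,
      ∃ v : ℝ,
        Tendsto (fun t : ℝ => (1 / t) * ‖position p ⟨_, hX t⟩‖) atTop (𝓝 v) ∧
        v ≤ (4 * Real.pi * (p : ℝ) ^ 2 * (2 / γ) ^ (p - 1)) / μ ^ (p - 1) := by
  have hμ0 := (two_mul_hatC_le_sq hμ).1
  obtain ⟨hgap, hbound⟩ := two_div_gap_pow_le hp hη₀ hγ0 (hγ.2 hΓ.1) hμ
  have hb : 0 < (μ * γ - 9 / 2) ^ (p - 1) := pow_pos (by linarith) _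
  have hsep : ∀ j < p, ∀ k < p, j ≠ k → μ * γ ≤ |μ * V j - μ * V k| := by
    intro j hj k hk hjk
    rw [← mul_sub, abs_mul, abs_of_pos hμ0]
    refine mul_le_mul_of_nonneg_left (hγ.2 ⟨j, k, ?_, ?_, rfl⟩) hμ0.le
    · rw [abs_pos]
      omega
    · rw [abs_lt]
      omega
  obtain ⟨Q, K, hc, hQ, hQn⟩ := exists_velocity (by omega) (periodic_bounded hp hV) hV μ hb
    fun x hx => by
      -- The radius 9/4 exceeds 2, as the cone argument needs, while 2r = 9/2 stays below the 4.8
      -- guaranteed for p = 2.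
      have h := le_abs_derivative_discriminant (v := fun n => μ * V n) (p := p) (by omega)
        (g := μ * γ) (r := 9 / 4) (by norm_num) (by linarith) (by linarith) hsep hx
      have e : μ * γ - 2 * (9 / 4) = μ * γ - 9 / 2 := by ring
      rwa [e] at h
  obtain ⟨hX, hlim⟩ := exists_tendsto_velocity
    (hamiltonian_isSelfAdjoint V (periodic_bounded hp hV) μ) hc hQ
  refine ⟨hX, _, hlim, ?_⟩
  have h := Q.le_opNorm (delta 0)
  rw [norm_delta, mul_one] at h
  exact h.trans (hQn.trans hbound)
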